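/- Let $X$ be a finite CW complex, let $d\ge 1$ be an integer (with $d\le\dim X$, although this is not needed), let $X_k$ be the set of $k$-cells of $X$, let $E:X_{d-1}\to\mathbb R$ and $\beta>0$. Choose orientations of the cells, let $C_*(X;A)$ be the cellular chain complex with coefficients in $A$, with boundary operator $\partial$, cycles $Z_*$, boundaries $B_*$ and homology $H_*=Z_*/B_*$, and let $\partial^*:C_{d-1}(X;\mathbb R)\to C_d(X;\mathbb R)$ be the adjoint of $\partial$ for the inner products in which the cells are orthonormal. Let $e^{\beta E}$ be the operator on $C_{d-1}(X;\mathbb R)$ with $b\mapsto e^{\beta E_b}b$ for $b\in X_{d-1}$. Call $\rho\in Z_{d-1}(X;\mathbb R)$ co-closed if $\partial^*e^{\beta E}\rho=0$. A $(d-1)$-dimensional spanning co-tree of $X$ is a subcomplex $L$ with $X^{(d-2)}\subset L\subset X^{(d-1)}$ such that the inclusion induces an isomorphism $H_{d-1}(L;\mathbb Q)\to H_{d-1}(X;\mathbb Q)$ and such that $\dim H_{d-2}(L;\mathbb Q)=\dim H_{d-2}(X;\mathbb Q)$ (an empty condition for $d=1$). Let $\phi_L: Z_{d-1}(L)\to H_{d-1}(X)$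 send a cycle to its homology class, and put $$\tau_L=|H_{d-1}(X,L;\mathbb Z)|^2\prod_{b\in L_{d-1}}e^{-\beta E_b},\qquad \nabla=\sum_L\tau_L,\qquad \Psi=\frac1\nabla\sum_L\tau_L\psi_L: H_{d-1}(X;\mathbb R)\to Z_{d-1}(X;\mathbb R),$$ where the sums run over all $(d-1)$-dimensional spanning co-trees $L$, and $\psi_L$ is the inverse of $\phi_L$ over $\mathbb R$ followed by the inclusion $Z_{d-1}(L;\mathbb R)\subset Z_{d-1}(X;\mathbb R)$. Then these expressions are well defined: there are only finitely many such $L$, $\nabla>0$, and for each $L$ the group $H_{d-1}(X,L;\mathbb Z)$ is finite and $\phi_L$ is an isomorphism over $\mathbb Q$ and over $\mathbb R$. Moreover, for every $x\in H_{d-1}(X;\mathbb R)$ there is exactly one co-closed cycle $\rho\in Z_{d-1}(X;\mathbb R)$ representing $x$, namely $\rho=\Psi(x)$. -/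

import Mathlib

open CategoryTheory Topology

universe u

noncomputable section

namespace BoltzmannSplitting

/-! ### Relative singular homology of pairs of spaces, with integer coefficients -/

/-- The integral singular chain complex, as a functor on topological spaces. -/
abbrev singularChains : TopCat.{u} ⥤ ChainComplex (ModuleCat.{u} ℤ) ℕ :=
  (AlgebraicTopology.singularChainComplexFunctor (ModuleCat.{u} ℤ)).obj
    (ModuleCat.of ℤ (ULift.{u} ℤ))

/-- The relative singular chain complex `S(X, A) = S(X) / S(A)` of a pair `P = (X, A)`. -/
abbrev relChains (P : TopPair.{u}) : ChainComplex (ModuleCat.{u} ℤ) ℕ :=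
  Limits.cokernel (singularChains.map P.map)

/-- The relative singular homology `H_k(X, A; ℤ)` of a pair `P = (X, A)`. -/
abbrev relHomology (P : TopPair.{u}) (k : ℕ) : ModuleCat.{u} ℤ :=
  (relChains P).homology k

/-- The map induced on relative singular chains by a map of pairs. -/
def relChainsMap {P Q : TopPair.{u}} (f : P ⟶ Q) : relChains P ⟶ relChains Q :=
  Limits.cokernel.map _ _ (singularChains.map (TopPair.Hom.snd f))
    (singularChains.map (TopPair.Hom.fst f))
    (by rw [← Functor.map_comp, ← Functor.map_comp, TopPair.Hom.w])

/-- The map induced on relative singular homology by a map of pairs. -/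
def relHomologyMap {P Q : TopPair.{u}} (f : P ⟶ Q) (k : ℕ) :
    relHomology P k ⟶ relHomology Q k :=
  HomologicalComplex.homologyMap (relChainsMap f) k

/-- The sequence `S(A) ⟶ S(X) ⟶ S(X, A)` of chain complexes. -/
def pairSequence (P : TopPair.{u}) : ShortComplex (ChainComplex (ModuleCat.{u} ℤ) ℕ) :=
  ShortComplex.mk (singularChains.map P.map) (Limits.cokernel.π (singularChains.map P.map))
    (Limits.cokernel.condition _)

instance : singularChains.{u}.PreservesMonomorphisms := by
  have : Limits.HasLimits.{u} (ModuleCat.{u} ℤ) := inferInstance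
  have : Limits.HasPullbacks (ModuleCat.{u} ℤ) := inferInstance
  infer_instance

instance mono_map (P : TopPair.{u}) : Mono P.map :=
  (TopCat.mono_iff_injective _).2 P.isEmbedding_map.injective

lemma pairSequence_shortExact (P : TopPair.{u}) : (pairSequence P).ShortExact where
  exact := ShortComplex.exact_cokernel (singularChains.map P.map)
  mono_f := inferInstanceAs (Mono (singularChains.map P.map))
  epi_g := inferInstanceAs (Epi (Limits.cokernel.π (singularChains.map P.map)))

/-- The connecting homomorphism `H_{k+1}(X, A) ⟶ H_k(A)` of a pair `P = (X, A)`. -/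
def connecting (P : TopPair.{u}) (k : ℕ) :
    relHomology P (k + 1) ⟶ (singularChains.obj P.snd).homology k :=
  (pairSequence_shortExact P).δ (k + 1) k (by simp)

/-- The map `H_k(X) ⟶ H_k(X, A)` of a pair `P = (X, A)`. -/
def toRel (P : TopPair.{u}) (k : ℕ) :
    (singularChains.obj P.fst).homology k ⟶ relHomology P k :=
  HomologicalComplex.homologyMap (Limits.cokernel.π (singularChains.map P.map)) k

lemma toRel_connecting (P : TopPair.{u}) (k : ℕ) : toRel P (k + 1) ≫ connecting P k = 0 :=
  (pairSequence_shortExact P).comp_δ (k + 1) k (by simp)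

/-! ### The cellular chain complex of a CW complex -/

/-- The pair `(D^k, S^{k-1})`, where the `k`-disc is the closed unit ball used for the cells of a
CW complex. -/
abbrev discPair (k : ℕ) : TopPair.{u} :=
  TopPair.ofSubset (X := TopCat.of (ULift.{u} (Metric.closedBall (0 : Fin k → ℝ) 1)))
    {p | (p.down : Fin k → ℝ) ∈ Metric.sphere 0 1}

variable {X : Type u} [TopologicalSpace X] [T2Space X] (C : Set X) [CWComplex C]

/-- The `(k-1)`-skeleton of a CW complex, as a space; it is empty for `k = 0`. -/
abbrev skelLT (k : ℕ) : TopCat.{u} :=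
  TopCat.of (CWComplex.skeletonLT C (k : ℕ∞) : Set X)

lemma skelLT_subset (k : ℕ) : (CWComplex.skeletonLT C (k : ℕ∞) : Set X) ⊆
    CWComplex.skeletonLT C ((k + 1 : ℕ) : ℕ∞) :=
  RelCWComplex.skeletonLT_mono (by exact_mod_cast Nat.le_succ k)

/-- The pair `(X^{(k)}, X^{(k-1)})` of skeleta. -/
abbrev skelPair (k : ℕ) : TopPair.{u} :=
  TopPair.of (A := skelLT C k) (X := skelLT C (k + 1))
    (TopCat.ofHom ⟨Set.inclusion (skelLT_subset C k), continuous_inclusion (skelLT_subset C k)⟩)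
    (IsEmbedding.inclusion (skelLT_subset C k))

/-- The characteristic map of a `k`-cell, as a map of pairs
`(D^k, S^{k-1}) ⟶ (X^{(k)}, X^{(k-1)})`. -/
def charMap (k : ℕ) (e : RelCWComplex.cell C k) : discPair.{u} k ⟶ skelPair C k :=
  TopPair.ofHom (X := discPair.{u} k) (Y := skelPair C k)
    (TopCat.ofHom
      { toFun := fun p => ⟨RelCWComplex.map k e p.down.1,
          RelCWComplex.closedCell_subset_skeletonLT k e ⟨p.down.1, p.down.2, rfl⟩⟩
        continuous_toFun := Continuous.subtype_mk
          ((RelCWComplex.continuousOn k e).comp_continuous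
            (continuous_subtype_val.comp continuous_uliftDown) fun p => p.down.2) _ })
    (TopCat.ofHom
      { toFun := fun p => ⟨RelCWComplex.map k e p.1.down.1,
          RelCWComplex.cellFrontier_subset_skeletonLT k e ⟨p.1.down.1, p.2, rfl⟩⟩
        continuous_toFun := Continuous.subtype_mk
          ((RelCWComplex.continuousOn k e).comp_continuous
            (continuous_subtype_val.comp (continuous_uliftDown.comp continuous_subtype_val))
            fun p => p.1.down.2) _ })
    rfl

/-- A choice of orientations of the cells of a CW complex: for each `k`-cell, one of the two
generators of the infinite cyclic group `H_k(D^k, S^{k-1}; ℤ)`. -/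
structure CellOrientation where
  /-- The chosen generator. -/
  gen (k : ℕ) (e : RelCWComplex.cell C k) : relHomology (discPair.{u} k) k
  /-- It generates the group. -/
  span_gen (k : ℕ) (e : RelCWComplex.cell C k) : Submodule.span ℤ {gen k e} = ⊤

/-- The differential `H_{k+1}(X^{(k+1)}, X^{(k)}) ⟶ H_k(X^{(k)}) ⟶ H_k(X^{(k)}, X^{(k-1)})`. -/
def skelDifferential (k : ℕ) :
    relHomology (skelPair C (k + 1)) (k + 1) ⟶ relHomology (skelPair C k) k :=
  connecting (skelPair C (k + 1)) k ≫ toRel (skelPair C k) k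

lemma skelDifferential_comp (k : ℕ)
    (x : relHomology (skelPair C (k + 2)) (k + 2)) :
    (skelDifferential C k).hom ((skelDifferential C (k + 1)).hom x) = 0 := by
  have h := congrArg (fun f => f.hom ((connecting (skelPair C (k + 2)) (k + 1)).hom x))
    (toRel_connecting (skelPair C (k + 1)) k)
  have h' := congrArg (fun y => (toRel (skelPair C k) k).hom y) h
  exact h'.trans (map_zero _)

variable [CWComplex.Finite C]

/-- A finite CW complex has finitely many cells in each dimension. -/
instance fintypeCell (k : ℕ) : Fintype (RelCWComplex.cell C k) :=
  @Fintype.ofFinite _ (RelCWComplex.FiniteType.finite_cell k)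

variable {C} (o : CellOrientation C)

/-- The homomorphism `ℤ[X_k] → H_k(X^{(k)}, X^{(k-1)}; ℤ)` which sends a `k`-cell to the image of
its orientation under its characteristic map. It is the standard isomorphism that identifies the
`k`-th cellular chain group with the free abelian group on the `k`-cells; integer-valued functions
on the finite set of `k`-cells stand for elements of the free abelian group. -/
def cellClass (k : ℕ) : (RelCWComplex.cell C k → ℤ) →ₗ[ℤ] relHomology (skelPair C k) k :=
  Fintype.linearCombination ℤ fun e => (relHomologyMap (charMap C k e) k).hom (o.gen k e)

/-- The inverse of a linear map. As usual for a total function, it takes the value `0` on maps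
which are not bijective. -/
def linInverse {R M N : Type*} [Ring R] [AddCommGroup M] [Module R M] [AddCommGroup N]
    [Module R N] (f : M →ₗ[R] N) : N →ₗ[R] M :=
  open Classical in
  if h : Function.Bijective f then (LinearEquiv.ofBijective f h).symm.toLinearMap else 0

lemma linInverse_eq_zero_or {R M N : Type*} [Ring R] [AddCommGroup M] [Module R M]
    [AddCommGroup N] [Module R N] (f : M →ₗ[R] N) :
    linInverse f = 0 ∨ ∀ y, f (linInverse f y) = y := by
  classical
  unfold linInverse
  split_ifs with h
  · exact Or.inr fun y => (LinearEquiv.ofBijective f h).apply_symm_apply y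
  · exact Or.inl rfl

/-- The integral cellular boundary operator `C_{k+1}(X; ℤ) → C_k(X; ℤ)`: the differential
`H_{k+1}(X^{(k+1)}, X^{(k)}) → H_k(X^{(k)}, X^{(k-1)})`, written in the bases of oriented cells. -/
def intBoundary (k : ℕ) : (RelCWComplex.cell C (k + 1) → ℤ) →ₗ[ℤ] (RelCWComplex.cell C k → ℤ) :=
  linInverse (cellClass o k) ∘ₗ (skelDifferential C k).hom ∘ₗ cellClass o (k + 1)

lemma intBoundary_comp (k : ℕ) : intBoundary o k ∘ₗ intBoundary o (k + 1) = 0 := by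
  refine LinearMap.ext fun c => ?_
  rcases linInverse_eq_zero_or (cellClass o (k + 1)) with h | h
  · simp [intBoundary, h]
  · simp only [intBoundary, LinearMap.comp_apply, h, skelDifferential_comp, map_zero,
      LinearMap.zero_apply]

open Classical in
/-- The incidence numbers: the entry at `(f, e)` is the coefficient of the `k`-cell `f` in the
boundary of the `(k+1)`-cell `e`. -/
def incidence (k : ℕ) : Matrix (RelCWComplex.cell C k) (RelCWComplex.cell C (k + 1)) ℤ :=
  LinearMap.toMatrix' (intBoundary o k)

lemma incidence_mul (k : ℕ) : incidence o k * incidence o (k + 1) = 0 := by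
  classical
  have h := LinearMap.toMatrix'_comp (intBoundary o k) (intBoundary o (k + 1))
  rw [intBoundary_comp, map_zero] at h
  unfold incidence
  convert h.symm

section Coefficients

variable (R : Type) [CommRing R]

variable (C) in
/-- The cellular chains `C_k(X; R)`: the free `R`-module on the finite set of `k`-cells, whose
elements are written as functions on the set of `k`-cells. -/
abbrev Chain (k : ℕ) : Type u := RelCWComplex.cell C k → R

/-- The cellular boundary operator `∂ : C_{k+1}(X; R) → C_k(X; R)`. -/
def boundary (k : ℕ) : Chain C R (k + 1) →ₗ[R] Chain C R k :=
  ((incidence o k).map (fun a : ℤ => (a : R))).mulVecLin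

lemma boundary_comp (k : ℕ) : boundary o R k ∘ₗ boundary o R (k + 1) = 0 := by
  have h := congrArg (fun A => A.map (Int.castRingHom R)) (incidence_mul o k)
  simp only [Matrix.map_mul] at h
  rw [boundary, boundary, ← Matrix.mulVecLin_mul]
  refine (congrArg Matrix.mulVecLin h).trans ?_
  ext
  simp

/-- The cycles `Z_k(X; R)`; all chains of degree `0` are cycles. -/
def cycles : (k : ℕ) → Submodule R (Chain C R k)
  | 0 => ⊤
  | k + 1 => LinearMap.ker (boundary o R k)

/-- The boundaries `B_k(X; R)`. -/
def boundaries (k : ℕ) : Submodule R (Chain C R k) := LinearMap.range (boundary o R k)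

lemma boundaries_le_cycles (k : ℕ) : boundaries o R k ≤ cycles o R k := by
  cases k with
  | zero => exact le_top
  | succ k =>
    rintro _ ⟨c, rfl⟩
    exact congrArg (fun f => f c) (boundary_comp o R k)

/-- The cellular homology `H_k(X; R) = Z_k(X; R) / B_k(X; R)`. -/
abbrev Homology (k : ℕ) : Type u :=
  cycles o R k ⧸ (boundaries o R k).submoduleOf (cycles o R k)

/-- The homology class of a cycle. -/
abbrev homologyClass (k : ℕ) : cycles o R k →ₗ[R] Homology o R k :=
  ((boundaries o R k).submoduleOf (cycles o R k)).mkQ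

variable (L : CWComplex.Subcomplex C)

/-- The cellular chains `C_k(L; R) ⊆ C_k(X; R)` of a subcomplex `L` of `X`. -/
def subChains (k : ℕ) : Submodule R (Chain C R k) where
  carrier := {c | ∀ e, e ∉ L.I k → c e = 0}
  add_mem' hc hd e he := by simp [hc e he, hd e he]
  zero_mem' _ _ := rfl
  smul_mem' a c hc e he := by simp [hc e he]

/-- The cycles `Z_k(L; R)` of a subcomplex. -/
def subCycles (k : ℕ) : Submodule R (Chain C R k) := subChains R L k ⊓ cycles o R k

/-- The boundaries `B_k(L; R)` of a subcomplex. -/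
def subBoundaries (k : ℕ) : Submodule R (Chain C R k) :=
  (subChains R L (k + 1)).map (boundary o R k)

/-- The cellular homology `H_k(L; R)` of a subcomplex. -/
abbrev SubHomology (k : ℕ) : Type u :=
  subCycles o R L k ⧸ (subBoundaries o R L k).submoduleOf (subCycles o R L k)

/-- The inclusion `Z_k(L; R) → Z_k(X; R)`. -/
def inclCycles (k : ℕ) : subCycles o R L k →ₗ[R] cycles o R k :=
  Submodule.inclusion inf_le_right

/-- The homomorphism `H_k(L; R) → H_k(X; R)` induced by the inclusion. -/
def inclHomology (k : ℕ) : SubHomology o R L k →ₗ[R] Homology o R k :=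
  Submodule.mapQ _ _ (inclCycles o R L k) (by
    rintro z ⟨w, -, hw⟩
    exact ⟨w, hw⟩)

/-- The relative cycles: the chains of `X` whose boundary is a chain of `L`. -/
def relCycles : (k : ℕ) → Submodule R (Chain C R k)
  | 0 => ⊤
  | k + 1 => (subChains R L k).comap (boundary o R k)

/-- The relative cellular homology `H_k(X, L; R)`, i.e. the homology of `C(X; R) / C(L; R)`: the
relative cycles modulo the sums of a boundary and a chain of `L`. -/
abbrev RelCellHomology (k : ℕ) : Type u :=
  relCycles o R L k ⧸ (boundaries o R k ⊔ subChains R L k).submoduleOf (relCycles o R L k)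

/-- The homomorphism `φ_L`, with coefficients in `R`, which sends a cycle of `L` to its homology
class in `X`. -/
def phi (k : ℕ) : subCycles o R L k →ₗ[R] Homology o R k :=
  homologyClass o R k ∘ₗ inclCycles o R L k

/-- The homomorphism `ψ_L = i_L ∘ φ_L⁻¹ : H_k(X; R) → Z_k(X; R)`. -/
def psi (k : ℕ) : Homology o R k →ₗ[R] cycles o R k :=
  inclCycles o R L k ∘ₗ linInverse (phi o R L k)

end Coefficients

/-- `L` is an `n`-dimensional spanning co-tree of `X`. Here `skeletonLT C n` is the
`(n-1)`-skeleton, and there is no condition on Betti numbers of degree `-1` when `n = 0`. -/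
structure IsSpanningCotree (n : ℕ) (L : CWComplex.Subcomplex C) : Prop where
  /-- The inclusion induces an isomorphism on rational homology in degree `n`. -/
  bijective : Function.Bijective (inclHomology o ℚ L n)
  /-- The Betti numbers in degree `n - 1` agree. -/
  betti : ∀ m, m + 1 = n →
    Module.finrank ℚ (SubHomology o ℚ L m) = Module.finrank ℚ (Homology o ℚ m)
  /-- `L` contains the `(n-1)`-skeleton. -/
  skeleton_le : (CWComplex.skeletonLT C (n : ℕ∞) : Set X) ⊆ (L : Set X)
  /-- `L` is contained in the `n`-skeleton. -/
  le_skeleton : (L : Set X) ⊆ (CWComplex.skeleton C (n : ℕ∞) : Set X)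

/-- The type of `n`-dimensional spanning co-trees. -/
abbrev SpanningCotree (n : ℕ) : Type u :=
  {L : CWComplex.Subcomplex C // IsSpanningCotree o n L}

section Weights

variable (n : ℕ) (E : RelCWComplex.cell C n → ℝ) (β : ℝ)

/-- The weight `τ_L = |H_n(X, L; ℤ)|² ∏_{b ∈ L_n} e^{-β E_b}`. -/
def tau (L : CWComplex.Subcomplex C) : ℝ :=
  (Nat.card (RelCellHomology o ℤ L n) : ℝ) ^ 2 * ∏ᶠ b ∈ L.I n, Real.exp (-(β * E b))

/-- The sum `∇` of the weights of all spanning co-trees. -/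
def nabla : ℝ := ∑ᶠ L : SpanningCotree o n, tau o n E β L.1

/-- The operator `Ψ = (1/∇) ∑_L τ_L ψ_L`. -/
def Psi : Homology o ℝ n →ₗ[ℝ] cycles o ℝ n :=
  (nabla o n E β)⁻¹ • ∑ᶠ L : SpanningCotree o n, tau o n E β L.1 • psi o ℝ L.1 n

variable {n} in
/-- The modified inner product on `C_n(X; ℝ)`, for which the cells are orthogonal and the cell `b`
has square norm `e^{β E_b}`. -/
def weightedInner (v w : Chain C ℝ n) : ℝ :=
  ∑ b, Real.exp (β * E b) * (v b * w b)

variable {n} in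
/-- The operator `∂_E^* = ∂^* e^{βE} : C_n(X; ℝ) → C_{n+1}(X; ℝ)`, in which `∂^*` is the formal
adjoint (i.e. the transpose) of `∂` for the standard inner products. -/
def adjoint (v : Chain C ℝ n) : Chain C ℝ (n + 1) :=
  ((incidence o n).map (fun a : ℤ => (a : ℝ))).transpose.mulVec
    fun b => Real.exp (β * E b) * v b

/-- `∂_E^*` is the formal adjoint of `∂` for the standard inner product on `C_{n+1}(X; ℝ)` and the
modified one on `C_n(X; ℝ)`. -/
lemma weightedInner_boundary (a : Chain C ℝ (n + 1)) (v : Chain C ℝ n) :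
    weightedInner E β (boundary o ℝ n a) v = ∑ e, a e * adjoint o E β v e := by
  have h := Matrix.dotProduct_mulVec (fun b => Real.exp (β * E b) * v b)
    ((incidence o n).map (fun a : ℤ => (a : ℝ))) a
  rw [← Matrix.mulVec_transpose, dotProduct_comm _ a] at h
  refine Eq.trans ?_ h
  exact Finset.sum_congr rfl fun b _ => by
    simp only [boundary, Matrix.mulVecLin_apply]
    ring

end Weights

end BoltzmannSplitting

end

/-!
# The Boltzmann splitting in terms of spanning co-trees

The argument takes place in the integral chain group `C_n(X; ℤ)` and its lattice of boundaries. Fix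
a `ℤ`-basis of this lattice (`BoundaryBasis`), the columns of a matrix `N` with `r` columns and one
row for each `n`-cell. Over a field of characteristic zero, a subcomplex `L` between the `(n-1)`-
and the `n`-skeleton is a spanning co-tree if and only if `C_n(L)` is a complement of the boundaries
(`isSpanningCotree_iff`): the isomorphism in degree `n` says that `Z_n(L)` is a complement of the
boundaries in `Z_n(X)`, and the condition on Betti numbers says that `C_n(L) + Z_n(X) = C_n(X)`.
Hence spanning co-trees correspond to the nonzero maximal minors of `N`, where the minor `N_f` of
`L` consists of the rows of the cells missing from `L`. Integrality of the minors carries the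
condition from `ℚ` to `ℝ`. Moreover

* `H_n(X, L; ℤ)` is the cokernel of `N_f`, so it is finite of order `|det N_f|`, and `τ_L` is, up to
  a factor which does not depend on `L`, the number `det (N_f) ^ 2 * ∏ i, exp (β E (f i))`
  (`BoundaryBasis.tau_eq`);
* `ψ_L` sends the class of a cycle `z` to `z - N (N_f⁻¹ (z ∘ f))`
  (`BoundaryBasis.coe_psi_homologyClass`).

By Cramer's rule, `det N_f • N_f⁻¹ (z ∘ f)` has the minors of `N` with one column replaced by `z` as
its coordinates. The Cauchy–Binet formula then identifies the `τ`-weighted average of the `ψ_L` with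
the projection to the orthogonal complement of the boundaries for the modified inner product
(`Matrix.sum_weighted_transpose_mulVec_eq_zero`), and this complement consists of the co-closed
chains. Uniqueness holds since a co-closed boundary is orthogonal to itself.

No property of the incidence numbers is needed beyond `∂ ∘ ∂ = 0`, which is why no singular homology
has to be computed.
-/

/-! ### The Cauchy–Binet formula and integer matrices -/

open Matrix in
/-- The Cauchy–Binet formula, with the sum over all row selections `f : ι → α` instead of the
`ι`-element subsets of `α`: each subset is counted once per bijection with `ι`, which is where the
factorial comes from, and selections which are not injective contribute zero. -/
theorem Matrix.sum_det_submatrix_mul_det_submatrix {α ι R : Type*} [Fintype α] [Fintype ι]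
    [DecidableEq ι] [CommRing R] (A B : Matrix α ι R) :
    ∑ f : ι → α, (A.submatrix f id).det * (B.submatrix f id).det =
      (Fintype.card ι).factorial * (Aᵀ * B).det := by
  classical
  have key : (Aᵀ * B).det = ∑ f : ι → α, (A.submatrix f id).det * ∏ i, B (f i) i := by
    have h (f : ι → α) : (A.submatrix f id).det = (A.submatrix f id)ᵀ.det := (det_transpose _).symm
    simp only [h]
    simp only [det_apply, mul_apply, transpose_apply, submatrix_apply, id, Finset.prod_univ_sum,
      Fintype.piFinset_univ, Finset.smul_sum, Finset.sum_mul, Finset.prod_mul_distrib,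
      smul_mul_assoc]
    exact Finset.sum_comm
  have perm (σ : Equiv.Perm ι) : (Aᵀ * B).det =
      ∑ f : ι → α, (A.submatrix f id).det * (Equiv.Perm.sign σ • ∏ i, B (f (σ i)) i) := by
    rw [key]
    refine Fintype.sum_equiv (Equiv.arrowCongr σ (Equiv.refl α)) _ _ fun f => ?_
    have hdet : (A.submatrix (f ∘ σ.symm) id).det =
        Equiv.Perm.sign σ * (A.submatrix f id).det := by
      have := det_permute σ.symm (A.submatrix f id)
      simpa using this
    have : (Equiv.arrowCongr σ (Equiv.refl α)) f = f ∘ σ.symm := rfl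
    rw [this, hdet]
    simp only [Function.comp_apply, Equiv.symm_apply_apply, Units.smul_def, zsmul_eq_mul]
    have hs : ((Equiv.Perm.sign σ : ℤ) : R) * ((Equiv.Perm.sign σ : ℤ) : R) = 1 := by
      norm_cast
      simp
    linear_combination -((A.submatrix f id).det * ∏ i, B (f i) i) * hs
  calc ∑ f : ι → α, (A.submatrix f id).det * (B.submatrix f id).det
      = ∑ σ : Equiv.Perm ι, ∑ f : ι → α,
          (A.submatrix f id).det * (Equiv.Perm.sign σ • ∏ i, B (f (σ i)) i) := by
        rw [Finset.sum_comm]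
        exact Finset.sum_congr rfl fun f _ => by
          rw [det_apply (B.submatrix f id), Finset.mul_sum]
          rfl
    _ = (Fintype.card ι).factorial * (Aᵀ * B).det := by
        simp [← perm, Fintype.card_perm]

open Matrix in
/-- Cramer's rule combined with the Cauchy–Binet formula. When the rows `f` of `M` form an
invertible matrix, `z - M *ᵥ (M_f⁻¹ *ᵥ (z ∘ f))` is the representative of `z` modulo the column
space of `M` that vanishes on `f`. The weighted average of these representatives, with weights
`det (M_f) ^ 2 * ∏ i, w (f i)`, is orthogonal to the columns of `M` for the inner product with
weights `w`. -/
theorem Matrix.sum_weighted_transpose_mulVec_eq_zero {α ι K : Type*} [Fintype α] [Fintype ι]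
    [DecidableEq ι] [Field K] (M : Matrix α ι K) (w z : α → K) :
    ∑ f : ι → α, ((∏ i, w (f i)) * (M.submatrix f id).det ^ 2) •
      (Mᵀ *ᵥ (w * (z - M *ᵥ ((M.submatrix f id)⁻¹ *ᵥ (z ∘ f))))) = 0 := by
  classical
  set G : Matrix ι ι K := Mᵀ * diagonal w * M with hG
  have hdet (f : ι → α) (B : Matrix α ι K) : ((diagonal w * B).submatrix f id).det =
      (∏ i, w (f i)) * (B.submatrix f id).det := by
    rw [← det_mul_column]
    congr 1
    ext i j
    simp [diagonal_mul]
  -- Each term, cleared of the inverse by Cramer's rule.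
  have hterm (f : ι → α) : ((∏ i, w (f i)) * (M.submatrix f id).det ^ 2) •
      (Mᵀ *ᵥ (w * (z - M *ᵥ ((M.submatrix f id)⁻¹ *ᵥ (z ∘ f))))) =
      ((M.submatrix f id).det * ((diagonal w * M).submatrix f id).det) • (Mᵀ *ᵥ (w * z)) -
        G *ᵥ (((diagonal w * M).submatrix f id).det • (M.submatrix f id).cramer (z ∘ f)) := by
    have hw (v : α → K) : w * v = diagonal w *ᵥ v := by
      ext; simp [mulVec_diagonal]
    have hinv : ((∏ i, w (f i)) * (M.submatrix f id).det ^ 2) • ((M.submatrix f id)⁻¹ *ᵥ (z ∘ f)) =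
        ((diagonal w * M).submatrix f id).det • (M.submatrix f id).cramer (z ∘ f) := by
      rw [hdet]
      by_cases h : (M.submatrix f id).det = 0
      · simp [h]
      · rw [cramer_eq_adjugate_mulVec, inv_def, smul_mulVec, Ring.inverse_eq_inv', smul_smul]
        congr 1
        field_simp
    have hsplit (x : ι → K) : Mᵀ *ᵥ (w * (z - M *ᵥ x)) = Mᵀ *ᵥ (w * z) - G *ᵥ x := by
      rw [mul_sub, mulVec_sub, hw (M *ᵥ x), mulVec_mulVec, mulVec_mulVec, hG, Matrix.mul_assoc]
    rw [hsplit, smul_sub, ← mulVec_smul G, hinv, hdet]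
    congr 2
    ring
  -- Cauchy–Binet with the `i`-th column of `M` replaced by `z`.
  have hcramer : ∑ f : ι → α, ((diagonal w * M).submatrix f id).det •
      (M.submatrix f id).cramer (z ∘ f) =
      ((Fintype.card ι).factorial : K) • G.cramer (Mᵀ *ᵥ (w * z)) := by
    ext i
    have hGi : (diagonal w * M)ᵀ * M.updateCol i z = G.updateCol i (Mᵀ *ᵥ (w * z)) := by
      rw [mul_updateCol, transpose_mul, diagonal_transpose, ← mulVec_mulVec]
      congr 2
      ext
      simp [mulVec_diagonal]
    have hcol (f : ι → α) : (M.submatrix f id).updateCol i (z ∘ f) =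
        (M.updateCol i z).submatrix f id := by
      ext a j
      by_cases h : j = i <;> simp [h]
    simp only [Finset.sum_apply, Pi.smul_apply, cramer_apply, smul_eq_mul, hcol, ← hGi]
    exact sum_det_submatrix_mul_det_submatrix (diagonal w * M) (M.updateCol i z)
  have hGT : Mᵀ * (diagonal w * M) = G := by rw [hG, Matrix.mul_assoc]
  simp only [hterm, Finset.sum_sub_distrib, ← Finset.sum_smul,
    sum_det_submatrix_mul_det_submatrix, hGT]
  rw [← mulVec_sum, hcramer, mulVec_smul, mulVec_cramer, smul_smul, sub_self]

/-- Full-rank factorisation of an integer matrix `D`: the columns of `N` are a `ℤ`-basis of the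
column lattice of `D`. The two factorisations make `N` and `D` have the same column space over
every commutative ring. -/
theorem Matrix.exists_int_fullRank_factorization {α κ : Type*} [Fintype α] [Fintype κ]
    (D : Matrix α κ ℤ) : ∃ (r : ℕ) (N : Matrix α (Fin r) ℤ) (A : Matrix (Fin r) κ ℤ)
      (A' : Matrix κ (Fin r) ℤ), D = N * A ∧ N = D * A' ∧ Function.Injective N.mulVec := by
  classical
  let b := Module.finBasis ℤ (LinearMap.range D.mulVecLin)
  have hN (x) : (Matrix.of fun a i => (b i : α → ℤ) a).mulVec x = ((∑ i, x i • b i :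
      LinearMap.range D.mulVecLin) : α → ℤ) := by
    ext a
    simp [Matrix.mulVec, dotProduct, mul_comm]
  have hA' (i) : ∃ y, D.mulVec y = (b i : α → ℤ) := (b i).2
  choose y hy using hA'
  refine ⟨_, Matrix.of fun a i => (b i : α → ℤ) a,
    Matrix.of fun i k => b.repr ⟨D.mulVec (Pi.single k 1), _, rfl⟩ i,
    Matrix.of fun k i => y i k, ?_, ?_, ?_⟩
  · ext a k
    have := congrFun (hN fun i => b.repr ⟨D.mulVec (Pi.single k 1), _, rfl⟩ i) a
    rw [b.sum_repr] at this
    simpa [Matrix.mulVec, dotProduct, Matrix.mul_apply, Pi.single_apply] using this.symm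
  · ext a i
    exact (congrFun (hy i) a).symm
  · intro x x' h
    rw [hN, hN] at h
    have := b.linearIndependent
    rw [Fintype.linearIndependent_iff] at this
    have h2 := this (x - x') (by simp [sub_smul, Subtype.ext h])
    ext i
    simpa [sub_eq_zero] using h2 i

/-- An integer matrix with independent columns has a nonzero maximal minor. -/
theorem Matrix.exists_submatrix_det_ne_zero {α ι : Type*} [Fintype α] [Fintype ι]
    [DecidableEq ι] (N : Matrix α ι ℤ) (hN : Function.Injective N.mulVec) :
    ∃ f : ι → α, (N.submatrix f id).det ≠ 0 := by
  by_contra! h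
  have hdet : (N.transpose * N).det = 0 := by
    have := Matrix.sum_det_submatrix_mul_det_submatrix N N
    simp only [h, mul_zero, Finset.sum_const_zero] at this
    exact (mul_eq_zero.1 this.symm).resolve_left (by exact_mod_cast Nat.factorial_ne_zero _)
  obtain ⟨v, hv, hv0⟩ := Matrix.exists_mulVec_eq_zero_iff.2 hdet
  refine hv (hN ?_)
  have : dotProduct (N.mulVec v) (N.mulVec v) = 0 := by
    rw [Matrix.dotProduct_mulVec, Matrix.vecMul_mulVec, ← Matrix.dotProduct_mulVec, hv0,
      dotProduct_zero]
  rw [dotProduct_self_eq_zero.1 this, Matrix.mulVec_zero]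

/-- The index of the lattice spanned by the columns of a square integer matrix is the absolute value
of the determinant. -/
theorem Matrix.card_quotient_range_mulVecLin {ι : Type*} [Fintype ι] [DecidableEq ι]
    (A : Matrix ι ι ℤ) (hA : A.det ≠ 0) :
    Nat.card ((ι → ℤ) ⧸ LinearMap.range A.mulVecLin) = A.det.natAbs := by
  have hinj : Function.Injective A.mulVecLin := Matrix.mulVec_injective_of_det_ne_zero hA
  rw [← Submodule.natAbs_det_equiv _ (LinearEquiv.ofInjective A.mulVecLin hinj),
    ← LinearMap.det_toLin']
  rfl

namespace BoltzmannSplitting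

/-! ### Subcomplexes between two consecutive skeleta -/

section Subcomplexes

variable {X : Type u} [TopologicalSpace X] [T2Space X] {C : Set X} [CWComplex C]

lemma mem_I_iff (L : CWComplex.Subcomplex C) {m : ℕ} (e : RelCWComplex.cell C m) :
    e ∈ L.I m ↔ RelCWComplex.openCell m e ⊆ (L : Set X) := by
  refine ⟨L.openCell_subset_of_mem, fun h => ?_⟩
  by_contra he
  have hd := L.disjoint_openCell_subcomplex_of_not_mem he
  exact (RelCWComplex.openCell_nonempty m e).ne_empty (hd.eq_bot_of_le h)

lemma coe_subset_coe_iff (K L : CWComplex.Subcomplex C) :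
    (K : Set X) ⊆ L ↔ ∀ m, K.I m ⊆ L.I m := by
  refine ⟨fun h m e he => (mem_I_iff L e).2 (((mem_I_iff K e).1 he).trans h), fun h => ?_⟩
  rw [← CWComplex.Subcomplex.union (E := K)]
  exact Set.iUnion₂_subset fun m e => (mem_I_iff L _).1 (h m e.2)

lemma subcomplex_ext {K L : CWComplex.Subcomplex C} (h : ∀ m, K.I m = L.I m) : K = L :=
  SetLike.coe_injective (((coe_subset_coe_iff K L).2 fun m => (h m).le).antisymm
    ((coe_subset_coe_iff L K).2 fun m => (h m).ge))

lemma mem_skeletonLT_I (n : ℕ∞) {m : ℕ} (e : RelCWComplex.cell C m) :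
    e ∈ (CWComplex.skeletonLT C n).I m ↔ (m : ℕ∞) < n := by
  simp [RelCWComplex.skeletonLT_I]

lemma skeletonLT_subset_iff (n : ℕ) (L : CWComplex.Subcomplex C) :
    (CWComplex.skeletonLT C (n : ℕ∞) : Set X) ⊆ L ↔
      ∀ m < n, ∀ e : RelCWComplex.cell C m, e ∈ L.I m := by
  rw [coe_subset_coe_iff]
  simp only [Set.subset_def, mem_skeletonLT_I, Nat.cast_lt]
  exact forall_congr' fun m => forall_comm

lemma subset_skeleton_iff (n : ℕ) (L : CWComplex.Subcomplex C) :
    (L : Set X) ⊆ (CWComplex.skeleton C (n : ℕ∞) : Set X) ↔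
      ∀ m, n < m → ∀ e : RelCWComplex.cell C m, e ∉ L.I m := by
  have h (m : ℕ) : (m : ℕ∞) < (n : ℕ∞) + 1 ↔ m ≤ n := by
    norm_cast
    exact Nat.lt_succ_iff
  rw [coe_subset_coe_iff]
  simp only [Set.subset_def, mem_skeletonLT_I, h]
  exact forall_congr' fun m => ⟨fun H hm e he => absurd (H e he) (by omega),
    fun H e he => not_lt.1 fun hm => H hm e he⟩

variable (C) in
/-- The union of the `(n-1)`-skeleton and a set `S` of `n`-cells. -/
def skeletonWithCells (n : ℕ) (S : Set (RelCWComplex.cell C n)) : CWComplex.Subcomplex C :=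
  CWComplex.Subcomplex.mk' C
    ((CWComplex.skeletonLT C (n : ℕ∞) : Set X) ∪ ⋃ e ∈ S, RelCWComplex.openCell n e)
    (fun m => {e | m < n ∨ (⟨m, e⟩ : Σ k, RelCWComplex.cell C k) ∈ Sigma.mk n '' S})
    (by
      rintro m ⟨e, hm | ⟨e', he', h⟩⟩
      · refine Set.subset_union_of_subset_left ?_ _
        exact (RelCWComplex.closedCell_subset_skeletonLT m e).trans
          (RelCWComplex.skeletonLT_mono (by exact_mod_cast hm))
      · cases h
        rw [← RelCWComplex.cellFrontier_union_openCell_eq_closedCell]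
        exact Set.union_subset_union (RelCWComplex.cellFrontier_subset_skeletonLT n e')
          (Set.subset_biUnion_of_mem (u := fun e => RelCWComplex.openCell n e) he'))
    (by
      rw [← CWComplex.iUnion_openCell_eq_skeletonLT]
      ext x
      simp only [Set.mem_iUnion, Set.mem_union]
      constructor
      · rintro ⟨m, ⟨e, hm | ⟨e', he', h⟩⟩, hx⟩
        · exact Or.inl ⟨m, by exact_mod_cast hm, e, hx⟩
        · cases h
          exact Or.inr ⟨e', he', hx⟩
      · rintro (⟨m, hm, e, hx⟩ | ⟨e, he, hx⟩)
        · exact ⟨m, ⟨e, Or.inl (by exact_mod_cast hm)⟩, hx⟩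
        · exact ⟨n, ⟨e, Or.inr ⟨e, he, rfl⟩⟩, hx⟩)

lemma mem_skeletonWithCells_I (n : ℕ) (S : Set (RelCWComplex.cell C n)) {m : ℕ}
    (e : RelCWComplex.cell C m) : e ∈ (skeletonWithCells C n S).I m ↔
      m < n ∨ (⟨m, e⟩ : Σ k, RelCWComplex.cell C k) ∈ Sigma.mk n '' S := Iff.rfl

lemma skeletonWithCells_I (n : ℕ) (S : Set (RelCWComplex.cell C n)) :
    (skeletonWithCells C n S).I n = S := by
  ext e
  simp [mem_skeletonWithCells_I]

lemma skeletonLT_subset_skeletonWithCells (n : ℕ) (S : Set (RelCWComplex.cell C n)) :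
    (CWComplex.skeletonLT C (n : ℕ∞) : Set X) ⊆ skeletonWithCells C n S :=
  (skeletonLT_subset_iff n _).2 fun _ hm _ => Or.inl hm

lemma skeletonWithCells_subset_skeleton (n : ℕ) (S : Set (RelCWComplex.cell C n)) :
    (skeletonWithCells C n S : Set X) ⊆ (CWComplex.skeleton C (n : ℕ∞) : Set X) := by
  refine (subset_skeleton_iff n _).2 fun m hm e he => ?_
  rcases he with h | ⟨_, _, h⟩
  · exact absurd h (by omega)
  · cases h
    exact lt_irrefl _ hm

/-- A subcomplex between the `(n-1)`-skeleton and the `n`-skeleton is determined by its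
`n`-cells. -/
lemma eq_of_I_eq {n : ℕ} {K L : CWComplex.Subcomplex C}
    (hK : (CWComplex.skeletonLT C (n : ℕ∞) : Set X) ⊆ K)
    (hK' : (K : Set X) ⊆ (CWComplex.skeleton C (n : ℕ∞) : Set X))
    (hL : (CWComplex.skeletonLT C (n : ℕ∞) : Set X) ⊆ L)
    (hL' : (L : Set X) ⊆ (CWComplex.skeleton C (n : ℕ∞) : Set X))
    (h : K.I n = L.I n) : K = L := by
  rw [skeletonLT_subset_iff] at hK hL
  rw [subset_skeleton_iff] at hK' hL'
  refine subcomplex_ext fun m => ?_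
  rcases lt_trichotomy m n with hm | rfl | hm
  · ext e
    exact iff_of_true (hK m hm e) (hL m hm e)
  · exact h
  · ext e
    exact iff_of_false (hK' m hm e) (hL' m hm e)

end Subcomplexes

/-! ### Spanning co-trees as complements of the space of boundaries -/

lemma subChains_eq_top {X : Type u} [TopologicalSpace X] {C : Set X} [CWComplex C]
    (R : Type) [CommRing R] {L : CWComplex.Subcomplex C} {m : ℕ}
    (h : ∀ e : RelCWComplex.cell C m, e ∈ L.I m) : subChains R L m = ⊤ :=
  eq_top_iff.2 fun _ _ e he => absurd (h e) he

section Complements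

variable {X : Type u} [TopologicalSpace X] [T2Space X] {C : Set X} [CWComplex C]
  [CWComplex.Finite C] (o : CellOrientation C) (R : Type) [CommRing R]
  {n : ℕ} {L : CWComplex.Subcomplex C}

lemma homologyClass_eq_zero_iff {k : ℕ} (z : cycles o R k) :
    homologyClass o R k z = 0 ↔ (z : Chain C R k) ∈ boundaries o R k := by
  rw [homologyClass, Submodule.mkQ_apply, Submodule.Quotient.mk_eq_zero]
  rfl

lemma homologyClass_eq_iff {k : ℕ} (y z : cycles o R k) :
    homologyClass o R k y = homologyClass o R k z ↔ (y - z : Chain C R k) ∈ boundaries o R k := by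
  rw [← sub_eq_zero, ← map_sub, homologyClass_eq_zero_iff]
  rfl

variable {R} in
lemma phi_bijective (h : IsCompl (subChains R L n) (boundaries o R n)) :
    Function.Bijective (phi o R L n) := by
  constructor
  · refine (injective_iff_map_eq_zero _).2 fun z hz => ?_
    have hb : (z : Chain C R n) ∈ boundaries o R n :=
      (homologyClass_eq_zero_iff o R _).1 hz
    exact Subtype.ext (Submodule.disjoint_def.1 h.disjoint _ z.2.1 hb)
  · intro x
    obtain ⟨z, rfl⟩ := Submodule.mkQ_surjective _ x
    obtain ⟨l, hl, b, hb, hz⟩ := Submodule.mem_sup.1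
      (h.sup_eq_top ▸ Submodule.mem_top : (z : Chain C R n) ∈ subChains R L n ⊔ boundaries o R n)
    have hlc : l ∈ cycles o R n := by
      rw [eq_sub_of_add_eq hz]
      exact sub_mem z.2 (boundaries_le_cycles o R n hb)
    refine ⟨⟨l, hl, hlc⟩, ?_⟩
    refine ((homologyClass_eq_iff o R z ⟨l, hlc⟩).2 ?_).symm
    simpa [← hz] using hb

lemma subBoundaries_eq_bot
    (hL : (L : Set X) ⊆ (CWComplex.skeleton C (n : ℕ∞) : Set X)) :
    subBoundaries o R L n = ⊥ := by
  rw [subset_skeleton_iff] at hL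
  rw [eq_bot_iff]
  rintro _ ⟨c, hc, rfl⟩
  have : c = 0 := funext fun e => hc e (hL (n + 1) (Nat.lt_succ_self n) e)
  simp [this]

/-- As `L` has no `(n+1)`-cells, its `n`-th homology is its group of cycles. -/
lemma inclHomology_bijective_iff
    (hL : (L : Set X) ⊆ (CWComplex.skeleton C (n : ℕ∞) : Set X)) :
    Function.Bijective (inclHomology o R L n) ↔ Function.Bijective (phi o R L n) := by
  have hb : Function.Bijective ((subBoundaries o R L n).submoduleOf (subCycles o R L n)).mkQ := by
    refine ⟨?_, Submodule.mkQ_surjective _⟩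
    rw [← LinearMap.ker_eq_bot, Submodule.ker_mkQ, subBoundaries_eq_bot o R hL]
    simp [Submodule.submoduleOf]
  have hcomp : phi o R L n = inclHomology o R L n ∘
      ((subBoundaries o R L n).submoduleOf (subCycles o R L n)).mkQ := rfl
  rw [hcomp, hb.of_comp_iff]

/-- For a subcomplex containing the `m`-skeleton, the condition on Betti numbers says that `L`
has the same `m`-boundaries as `X`. -/
lemma finrank_subHomology_eq_iff {m : ℕ} (h : ∀ e : RelCWComplex.cell C m, e ∈ L.I m) :
    Module.finrank ℚ (SubHomology o ℚ L m) = Module.finrank ℚ (Homology o ℚ m) ↔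
      boundaries o ℚ m ≤ subBoundaries o ℚ L m := by
  have hsurj : Function.Surjective (inclHomology o ℚ L m) := by
    intro x
    obtain ⟨z, rfl⟩ := Submodule.mkQ_surjective _ x
    exact ⟨Submodule.Quotient.mk ⟨z, by simp [subChains_eq_top ℚ h], z.2⟩, rfl⟩
  have hinj : Function.Injective (inclHomology o ℚ L m) ↔
      boundaries o ℚ m ≤ subBoundaries o ℚ L m := by
    rw [injective_iff_map_eq_zero]
    constructor
    · intro H b hb
      have := H (Submodule.Quotient.mk ⟨b, by simp [subChains_eq_top ℚ h],
        boundaries_le_cycles o ℚ m hb⟩)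
        ((homologyClass_eq_zero_iff o ℚ _).2 hb)
      exact (Submodule.Quotient.mk_eq_zero
        ((subBoundaries o ℚ L m).submoduleOf (subCycles o ℚ L m))).1 this
    · intro H x hx
      obtain ⟨z, rfl⟩ := Submodule.mkQ_surjective _ x
      exact (Submodule.Quotient.mk_eq_zero _).2 (H ((homologyClass_eq_zero_iff o ℚ _).1 hx))
  rw [← hinj]
  constructor
  · intro he
    exact (LinearMap.injective_iff_surjective_of_finrank_eq_finrank he).2 hsurj
  · intro hi
    exact (LinearEquiv.ofBijective _ ⟨hi, hsurj⟩).finrank_eq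

/-- Among the subcomplexes between the `(n-1)`- and the `n`-skeleton, the spanning co-trees are
those whose rational `n`-chains are a complement of the boundaries of `X`. -/
lemma isSpanningCotree_iff : IsSpanningCotree o n L ↔
    (CWComplex.skeletonLT C (n : ℕ∞) : Set X) ⊆ (L : Set X) ∧
      (L : Set X) ⊆ (CWComplex.skeleton C (n : ℕ∞) : Set X) ∧
      IsCompl (subChains ℚ L n) (boundaries o ℚ n) := by
  constructor
  · intro H
    refine ⟨H.skeleton_le, H.le_skeleton, ?_⟩
    have hphi := (inclHomology_bijective_iff o ℚ H.le_skeleton).1 H.bijective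
    constructor
    · rw [Submodule.disjoint_def]
      intro c hc hb
      have := (injective_iff_map_eq_zero _).1 hphi.1 ⟨c, hc, boundaries_le_cycles o ℚ n hb⟩
        ((homologyClass_eq_zero_iff o ℚ _).2 hb)
      exact congrArg Subtype.val this
    · rw [codisjoint_iff, eq_top_iff]
      have hcyc : cycles o ℚ n ≤ subChains ℚ L n ⊔ boundaries o ℚ n := by
        intro z hz
        obtain ⟨l, hl⟩ := hphi.2 (homologyClass o ℚ n ⟨z, hz⟩)
        have hb : homologyClass o ℚ n (⟨z, hz⟩ - inclCycles o ℚ L n l) = 0 := by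
          rw [map_sub, sub_eq_zero, ← hl]
          rfl
        rw [homologyClass_eq_zero_iff] at hb
        exact Submodule.mem_sup.2 ⟨l, l.2.1, _, hb, add_sub_cancel _ _⟩
      intro c _
      cases n with
      | zero => exact hcyc Submodule.mem_top
      | succ m =>
        have hlow := (skeletonLT_subset_iff _ _).1 H.skeleton_le m (Nat.lt_succ_self m)
        obtain ⟨l, hl, hlc⟩ := (finrank_subHomology_eq_iff o hlow).1 (H.betti m rfl) ⟨c, rfl⟩
        have hz : c - l ∈ cycles o ℚ (m + 1) := by
          change boundary o ℚ m (c - l) = 0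
          rw [map_sub, hlc, sub_self]
        rw [← sub_add_cancel c l]
        exact add_mem (hcyc hz) (Submodule.mem_sup_left hl)
  · rintro ⟨h1, h2, hc⟩
    refine ⟨(inclHomology_bijective_iff o ℚ h2).2 (phi_bijective o hc), ?_, h1, h2⟩
    rintro m rfl
    have hlow := (skeletonLT_subset_iff _ _).1 h1 m (Nat.lt_succ_self m)
    rw [finrank_subHomology_eq_iff o hlow]
    rintro _ ⟨c, rfl⟩
    obtain ⟨l, hl, b, hb, rfl⟩ := Submodule.mem_sup.1
      (hc.sup_eq_top ▸ Submodule.mem_top : c ∈ subChains ℚ L (m + 1) ⊔ boundaries o ℚ (m + 1))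
    have hb0 : boundary o ℚ m b = 0 := boundaries_le_cycles o ℚ (m + 1) hb
    exact ⟨l, hl, by rw [map_add, hb0, add_zero]⟩

end Complements

/-! ### Maximal minors of a basis of the boundary lattice -/

lemma linInverse_apply_self {R M N : Type*} [Ring R] [AddCommGroup M] [Module R M]
    [AddCommGroup N] [Module R N] {f : M →ₗ[R] N} (hf : Function.Bijective f) (x : M) :
    linInverse f (f x) = x := by
  rw [linInverse, dif_pos hf]
  exact (LinearEquiv.ofBijective f hf).symm_apply_apply x

lemma mem_subChains_iff {X : Type u} [TopologicalSpace X] {C : Set X} [CWComplex C] {n : ℕ}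
    {L : CWComplex.Subcomplex C} {R : Type} [CommRing R] {ι : Type*} {f : ι → RelCWComplex.cell C n}
    (hf : Set.range f = (L.I n)ᶜ) (c : Chain C R n) : c ∈ subChains R L n ↔ c ∘ f = 0 := by
  constructor
  · intro h
    exact funext fun i => h _ (hf.le ⟨i, rfl⟩)
  · intro h e he
    obtain ⟨i, rfl⟩ := hf.ge he
    exact congrFun h i

section Minors

open scoped Matrix

variable {X : Type u} [TopologicalSpace X] [T2Space X] {C : Set X} [CWComplex C]
  [CWComplex.Finite C] (o : CellOrientation C) (n : ℕ)

variable {n} in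
lemma homologyClass_psi {R : Type} [CommRing R] {L : CWComplex.Subcomplex C}
    (h : IsCompl (subChains R L n) (boundaries o R n)) (x : Homology o R n) :
    homologyClass o R n (psi o R L n x) = x := by
  obtain ⟨y, rfl⟩ := (phi_bijective o h).2 x
  rw [psi, LinearMap.comp_apply, linInverse_apply_self (phi_bijective o h)]
  rfl

variable {n} in
lemma coe_psi_homologyClass_eq_sub {R : Type} [CommRing R] {L : CWComplex.Subcomplex C}
    (h : IsCompl (subChains R L n) (boundaries o R n)) (z : cycles o R n) {b : Chain C R n}
    (hb : b ∈ boundaries o R n) (hL : (z - b : Chain C R n) ∈ subChains R L n) :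
    (psi o R L n (homologyClass o R n z) : Chain C R n) = z - b := by
  obtain ⟨y, hy⟩ : ∃ y : subCycles o R L n, (y : Chain C R n) = z - b :=
    ⟨⟨_, hL, sub_mem z.2 (boundaries_le_cycles o R n hb)⟩, rfl⟩
  have hyz : homologyClass o R n z = phi o R L n y := by
    refine (homologyClass_eq_iff o R z (inclCycles o R L n y)).2 ?_
    change (z - y : Chain C R n) ∈ _
    rwa [hy, sub_sub_cancel]
  rw [hyz, psi, LinearMap.comp_apply, linInverse_apply_self (phi_bijective o h), ← hy]
  rfl

/-- A `ℤ`-basis of the lattice `B_n(X; ℤ)` of integral boundaries, given as the columns of a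
matrix. The factorisations through the incidence matrix say that the columns span the lattice; in
this form the property passes to all rings of coefficients. -/
structure BoundaryBasis where
  /-- The rank of the lattice of boundaries. -/
  rank : ℕ
  /-- The matrix whose columns are the basis vectors. -/
  mat : Matrix (RelCWComplex.cell C n) (Fin rank) ℤ
  /-- The columns of the incidence matrix are combinations of the basis vectors. -/
  exists_incidence_eq : ∃ A : Matrix (Fin rank) (RelCWComplex.cell C (n + 1)) ℤ,
    incidence o n = mat * A
  /-- The basis vectors are boundaries. -/
  exists_eq_incidence : ∃ A : Matrix (RelCWComplex.cell C (n + 1)) (Fin rank) ℤ,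
    mat = incidence o n * A
  /-- The basis vectors are linearly independent. -/
  injective : Function.Injective mat.mulVec

lemma nonempty_boundaryBasis : Nonempty (BoundaryBasis o n) := by
  obtain ⟨r, N, A, A', h, h', hinj⟩ := (incidence o n).exists_int_fullRank_factorization
  exact ⟨⟨r, N, ⟨A, h⟩, ⟨A', h'⟩, hinj⟩⟩

variable {o n} (b : BoundaryBasis o n)

namespace BoundaryBasis

variable (R : Type) [CommRing R]

/-- The matrix of basis vectors, with coefficients in `R`. -/
def matR : Matrix (RelCWComplex.cell C n) (Fin b.rank) R := b.mat.map (Int.castRingHom R)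

/-- The maximal square submatrix of the matrix of basis vectors formed by the rows `f`. -/
abbrev minor (f : Fin b.rank → RelCWComplex.cell C n) : Matrix (Fin b.rank) (Fin b.rank) R :=
  (b.matR R).submatrix f id

lemma det_minor (f : Fin b.rank → RelCWComplex.cell C n) :
    (b.minor R f).det = ((b.mat.submatrix f id).det : ℤ) := by
  rw [minor, matR, Matrix.submatrix_map]
  exact ((Int.castRingHom R).map_det _).symm

lemma boundaries_eq_range : boundaries o R n = LinearMap.range (b.matR R).mulVecLin := by
  obtain ⟨A, hA⟩ := b.exists_incidence_eq
  obtain ⟨A', hA'⟩ := b.exists_eq_incidence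
  have h1 : boundary o R n = ((b.matR R) * A.map (Int.castRingHom R)).mulVecLin := by
    rw [matR, ← Matrix.map_mul, ← hA]
    rfl
  have h2 : (b.matR R).mulVecLin =
      boundary o R n ∘ₗ (A'.map (Int.castRingHom R)).mulVecLin := by
    rw [boundary, ← Matrix.mulVecLin_mul]
    refine congrArg Matrix.mulVecLin ?_
    rw [matR, hA', Matrix.map_mul]
    rfl
  apply le_antisymm
  · rw [boundaries, h1, Matrix.mulVecLin_mul]
    exact LinearMap.range_comp_le_range _ _
  · rw [h2]
    exact LinearMap.range_comp_le_range _ _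

/-- The coefficients of a chain at the rows `f` of a combination of the basis vectors. -/
lemma minor_mulVec (f : Fin b.rank → RelCWComplex.cell C n) (x : Fin b.rank → R) :
    b.minor R f *ᵥ x = (b.matR R *ᵥ x) ∘ f := rfl

lemma matR_mulVec_injective (K : Type) [Field K] [CharZero K] :
    Function.Injective (b.matR K).mulVec := by
  obtain ⟨f, hf⟩ := b.mat.exists_submatrix_det_ne_zero b.injective
  have hdet : (b.minor K f).det ≠ 0 := by rw [det_minor]; exact_mod_cast hf
  intro x y h
  exact Matrix.mulVec_injective_of_det_ne_zero hdet (congrArg (· ∘ f) h)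

section Field

variable {K : Type} [Field K] [CharZero K] {L : CWComplex.Subcomplex C}
  {f : Fin b.rank → RelCWComplex.cell C n}

/-- The class of `c` modulo boundaries has the representative `c - M (M_f⁻¹ (c ∘ f))` which is
supported outside of the rows `f`. -/
lemma sub_mem_subChains (hf : Set.range f = (L.I n)ᶜ) (hdet : (b.mat.submatrix f id).det ≠ 0)
    (c : Chain C K n) :
    c - b.matR K *ᵥ ((b.minor K f)⁻¹ *ᵥ (c ∘ f)) ∈ subChains K L n := by
  have hu : IsUnit (b.minor K f).det := by
    rw [det_minor, isUnit_iff_ne_zero]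
    exact_mod_cast hdet
  rw [mem_subChains_iff hf]
  change c ∘ f - (b.matR K *ᵥ ((b.minor K f)⁻¹ *ᵥ (c ∘ f))) ∘ f = 0
  rw [← minor_mulVec, Matrix.mulVec_mulVec, Matrix.mul_nonsing_inv _ hu, Matrix.one_mulVec,
    sub_self]

lemma isCompl (hf : Set.range f = (L.I n)ᶜ) (hdet : (b.mat.submatrix f id).det ≠ 0) :
    IsCompl (subChains K L n) (boundaries o K n) := by
  have hd : (b.minor K f).det ≠ 0 := by rw [det_minor]; exact_mod_cast hdet
  rw [b.boundaries_eq_range K]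
  constructor
  · rw [Submodule.disjoint_def]
    rintro _ hc ⟨x, rfl⟩
    rw [mem_subChains_iff hf] at hc
    have : x = 0 := Matrix.mulVec_injective_of_det_ne_zero hd (hc.trans (Matrix.mulVec_zero _).symm)
    rw [this, map_zero]
  · rw [codisjoint_iff, eq_top_iff]
    exact fun c _ => Submodule.mem_sup.2
      ⟨_, b.sub_mem_subChains hf hdet c, _, ⟨_, rfl⟩, sub_add_cancel _ _⟩

lemma det_ne_zero (hf : Set.range f = (L.I n)ᶜ)
    (h : Disjoint (subChains K L n) (boundaries o K n)) : (b.mat.submatrix f id).det ≠ 0 := by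
  intro h0
  have hd : (b.minor K f).det = 0 := by rw [det_minor, h0, Int.cast_zero]
  obtain ⟨v, hv, hv0⟩ := Matrix.exists_mulVec_eq_zero_iff.2 hd
  rw [b.boundaries_eq_range K, Submodule.disjoint_def] at h
  have := h (b.matR K *ᵥ v) ((mem_subChains_iff hf _).2 hv0) ⟨v, rfl⟩
  exact hv (b.matR_mulVec_injective K (this.trans (Matrix.mulVec_zero _).symm))

/-- If the chains of `L` are a complement of the boundaries, then as many `n`-cells are missing
from `L` as the rank of the lattice of boundaries. -/
lemma exists_injective_range_eq (h : IsCompl (subChains K L n) (boundaries o K n)) :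
    ∃ f : Fin b.rank → RelCWComplex.cell C n, Function.Injective f ∧ Set.range f = (L.I n)ᶜ := by
  classical
  rw [b.boundaries_eq_range K] at h
  let S := {e : RelCWComplex.cell C n // e ∉ L.I n}
  have hS : Set.range (Subtype.val : S → _) = (L.I n)ᶜ := Subtype.range_val
  let T : (Fin b.rank → K) →ₗ[K] (S → K) :=
    LinearMap.funLeft K K Subtype.val ∘ₗ (b.matR K).mulVecLin
  have hT : Function.Bijective T := by
    constructor
    · refine (injective_iff_map_eq_zero _).2 fun x hx => ?_
      have := Submodule.disjoint_def.1 h.disjoint (b.matR K *ᵥ x)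
        ((mem_subChains_iff hS _).2 hx) ⟨x, rfl⟩
      exact b.matR_mulVec_injective K (this.trans (Matrix.mulVec_zero _).symm)
    · intro y
      obtain ⟨c, hc⟩ := LinearMap.funLeft_surjective_of_injective K K _ Subtype.val_injective y
      obtain ⟨l, hl, _, ⟨x, rfl⟩, rfl⟩ := Submodule.mem_sup.1
        (h.sup_eq_top ▸ Submodule.mem_top : c ∈ _)
      rw [mem_subChains_iff hS] at hl
      refine ⟨x, ?_⟩
      rw [← hc, map_add]
      exact (zero_add _).symm.trans (congrArg (· + _) hl.symm)
  have hcard := (LinearEquiv.ofBijective T hT).finrank_eq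
  rw [Module.finrank_fintype_fun_eq_card, Module.finrank_fintype_fun_eq_card] at hcard
  let e := Fintype.equivOfCardEq hcard
  exact ⟨fun i => (e i).1, Subtype.val_injective.comp e.injective, by
    rw [← hS]; exact e.surjective.range_comp Subtype.val⟩

end Field

/-- `H_n(X, L; ℤ)` is the quotient of `ℤ^r` by the column lattice of the minor of the cells that are
missing from `L`. -/
lemma card_relCellHomology {L : CWComplex.Subcomplex C}
    (hL : (CWComplex.skeletonLT C (n : ℕ∞) : Set X) ⊆ (L : Set X))
    {f : Fin b.rank → RelCWComplex.cell C n} (hf : Set.range f = (L.I n)ᶜ)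
    (hinj : Function.Injective f) (hdet : (b.mat.submatrix f id).det ≠ 0) :
    Nat.card (RelCellHomology o ℤ L n) = (b.mat.submatrix f id).det.natAbs := by
  have htop : relCycles o ℤ L n = ⊤ := by
    cases n with
    | zero => rfl
    | succ m =>
      change (subChains ℤ L m).comap _ = ⊤
      rw [subChains_eq_top ℤ ((skeletonLT_subset_iff _ _).1 hL m (Nat.lt_succ_self m)),
        Submodule.comap_top]
  rw [← Matrix.card_quotient_range_mulVecLin _ hdet]
  let g : relCycles o ℤ L n →ₗ[ℤ]
      (Fin b.rank → ℤ) ⧸ LinearMap.range (b.mat.submatrix f id).mulVecLin :=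
    Submodule.mkQ _ ∘ₗ LinearMap.funLeft ℤ ℤ f ∘ₗ (relCycles o ℤ L n).subtype
  have hg : Function.Surjective g := by
    refine (Submodule.mkQ_surjective _).comp
      ((LinearMap.funLeft_surjective_of_injective ℤ ℤ f hinj).comp fun c => ?_)
    exact ⟨⟨c, htop ▸ Submodule.mem_top⟩, rfl⟩
  have hb : boundaries o ℤ n = LinearMap.range b.mat.mulVecLin := b.boundaries_eq_range ℤ
  have hker : LinearMap.ker g =
      (boundaries o ℤ n ⊔ subChains ℤ L n).submoduleOf (relCycles o ℤ L n) := by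
    ext c
    rw [LinearMap.mem_ker, Submodule.submoduleOf, Submodule.mem_comap, hb]
    change Submodule.Quotient.mk _ = 0 ↔ _
    rw [Submodule.Quotient.mk_eq_zero]
    constructor
    · rintro ⟨x, hx⟩
      refine Submodule.mem_sup.2 ⟨_, ⟨x, rfl⟩, _, (mem_subChains_iff hf _).2 ?_,
        add_sub_cancel _ _⟩
      exact sub_eq_zero.2 hx.symm
    · intro h
      obtain ⟨_, ⟨x, rfl⟩, l, hl, h⟩ := Submodule.mem_sup.1 h
      refine ⟨x, ?_⟩
      rw [mem_subChains_iff hf] at hl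
      change _ = (relCycles o ℤ L n).subtype c ∘ f
      rw [← h]
      exact (add_zero _).symm.trans (congrArg (_ + ·) hl.symm)
  rw [RelCellHomology, ← hker]
  exact Nat.card_congr (g.quotKerEquivOfSurjective hg).toEquiv

lemma tau_eq (E : RelCWComplex.cell C n → ℝ) (β : ℝ) {L : CWComplex.Subcomplex C}
    (hL : (CWComplex.skeletonLT C (n : ℕ∞) : Set X) ⊆ (L : Set X))
    {f : Fin b.rank → RelCWComplex.cell C n} (hf : Set.range f = (L.I n)ᶜ)
    (hinj : Function.Injective f) (hdet : (b.mat.submatrix f id).det ≠ 0) :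
    tau o n E β L = (∏ e, Real.exp (-(β * E e))) *
      ((∏ i, Real.exp (β * E (f i))) * (b.minor ℝ f).det ^ 2) := by
  classical
  have hprod : ∏ᶠ e ∈ L.I n, Real.exp (-(β * E e)) =
      (∏ e, Real.exp (-(β * E e))) * ∏ i, Real.exp (β * E (f i)) := by
    rw [finprod_mem_eq_finite_toFinset_prod _ (Set.toFinite _),
      ← Finset.prod_mul_prod_compl (Set.toFinite (L.I n)).toFinset]
    have hc : (Set.toFinite (L.I n)).toFinsetᶜ = Finset.univ.image f := by
      ext e
      have := Set.ext_iff.1 hf e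
      simpa using this.symm
    rw [hc, Finset.prod_image hinj.injOn, mul_assoc, ← Finset.prod_mul_distrib]
    simp [← Real.exp_add]
  rw [tau, hprod, b.card_relCellHomology hL hf hinj hdet, det_minor, Nat.cast_natAbs, Int.cast_abs,
    sq_abs]
  ring

lemma coe_psi_homologyClass {K : Type} [Field K] [CharZero K] {L : CWComplex.Subcomplex C}
    {f : Fin b.rank → RelCWComplex.cell C n} (hf : Set.range f = (L.I n)ᶜ)
    (hdet : (b.mat.submatrix f id).det ≠ 0) (z : cycles o K n) :
    (psi o K L n (homologyClass o K n z) : Chain C K n) =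
      z - b.matR K *ᵥ ((b.minor K f)⁻¹ *ᵥ ((z : Chain C K n) ∘ f)) := by
  have hb : b.matR K *ᵥ ((b.minor K f)⁻¹ *ᵥ ((z : Chain C K n) ∘ f)) ∈ boundaries o K n := by
    rw [b.boundaries_eq_range K]
    exact ⟨_, rfl⟩
  have hL := b.sub_mem_subChains (K := K) hf hdet (z : Chain C K n)
  exact coe_psi_homologyClass_eq_sub o (b.isCompl hf hdet) z hb hL

end BoundaryBasis

end Minors

/-! ### Sums over spanning co-trees as sums over minors -/

/-- The maps with the same range as an injective map `f` are the reparametrisations of `f`. -/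
lemma card_filter_range_eq {ι α : Type*} [Fintype ι] [DecidableEq ι] [Fintype α] {f : ι → α}
    (hf : Function.Injective f) [DecidablePred fun g : ι → α => Set.range g = Set.range f] :
    (Finset.univ.filter fun g : ι → α => Set.range g = Set.range f).card =
      (Fintype.card ι).factorial := by
  rw [← Fintype.card_perm, ← Finset.card_univ]
  symm
  refine Finset.card_bij (fun σ _ => f ∘ σ) (fun σ _ => ?_) (fun σ _ τ _ h => ?_) fun g hg => ?_
  · simp [σ.surjective.range_comp f]
  · exact Equiv.ext fun i => hf (congrFun h i)
  · have hg := (Finset.mem_filter.1 hg).2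
    choose s hs using fun i => hg.le ⟨i, rfl⟩
    have hsurj : Function.Surjective s := fun j => by
      obtain ⟨i, hi⟩ := hg.ge ⟨j, rfl⟩
      exact ⟨i, hf ((hs i).trans hi)⟩
    exact ⟨Equiv.ofBijective s (Finite.surjective_iff_bijective.1 hsurj), Finset.mem_univ _,
      funext hs⟩

section Sums

open scoped Matrix

variable {X : Type u} [TopologicalSpace X] [T2Space X] {C : Set X} [CWComplex C]
  [CWComplex.Finite C] (o : CellOrientation C) (n : ℕ)

instance finite_spanningCotree : Finite (SpanningCotree o n) :=
  Finite.of_injective (fun L : SpanningCotree o n => L.1.I n) fun K L h =>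
    Subtype.ext (eq_of_I_eq K.2.skeleton_le K.2.le_skeleton L.2.skeleton_le L.2.le_skeleton h)

variable {o n} (b : BoundaryBasis o n)

namespace BoundaryBasis

lemma exists_rows (L : SpanningCotree o n) : ∃ f : Fin b.rank → RelCWComplex.cell C n,
    Function.Injective f ∧ Set.range f = (L.1.I n)ᶜ ∧ (b.mat.submatrix f id).det ≠ 0 := by
  have h := ((isSpanningCotree_iff o).1 L.2).2.2
  obtain ⟨f, hinj, hf⟩ := b.exists_injective_range_eq h
  exact ⟨f, hinj, hf, b.det_ne_zero hf h.disjoint⟩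

/-- The spanning co-tree obtained by removing the `n`-cells which index a nonzero minor. -/
def cotreeOfRows (f : Fin b.rank → RelCWComplex.cell C n)
    (hdet : (b.mat.submatrix f id).det ≠ 0) : SpanningCotree o n :=
  ⟨skeletonWithCells C n (Set.range f)ᶜ, (isSpanningCotree_iff o).2
    ⟨skeletonLT_subset_skeletonWithCells n _, skeletonWithCells_subset_skeleton n _,
      b.isCompl (by rw [skeletonWithCells_I, compl_compl]) hdet⟩⟩

lemma cotreeOfRows_eq_iff {f : Fin b.rank → RelCWComplex.cell C n}
    (hdet : (b.mat.submatrix f id).det ≠ 0) (L : SpanningCotree o n) :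
    b.cotreeOfRows f hdet = L ↔ Set.range f = (L.1.I n)ᶜ := by
  have hI : (b.cotreeOfRows f hdet).1.I n = (Set.range f)ᶜ := skeletonWithCells_I n _
  rw [eq_compl_comm, ← hI, eq_comm (a := L.1.I n)]
  constructor
  · rintro rfl
    rfl
  · exact fun h => Subtype.ext (eq_of_I_eq (b.cotreeOfRows f hdet).2.skeleton_le
      (b.cotreeOfRows f hdet).2.le_skeleton L.2.skeleton_le L.2.le_skeleton h)

lemma injective_of_det_ne_zero {f : Fin b.rank → RelCWComplex.cell C n}
    (hdet : (b.mat.submatrix f id).det ≠ 0) : Function.Injective f := by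
  intro i j h
  by_contra hij
  exact hdet (Matrix.det_zero_of_row_eq hij (by ext; simp [h]))

/-- Each spanning co-tree is counted `r!` times, once for each ordering of its complement. -/
lemma sum_rows_eq {V : Type*} [AddCommGroup V] (T : (Fin b.rank → RelCWComplex.cell C n) → V)
    (S : SpanningCotree o n → V) (h0 : ∀ f, (b.mat.submatrix f id).det = 0 → T f = 0)
    (hS : ∀ (L : SpanningCotree o n) f, Set.range f = (L.1.I n)ᶜ →
      (b.mat.submatrix f id).det ≠ 0 → T f = S L) :
    ∑ f, T f = b.rank.factorial • ∑ᶠ L, S L := by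
  classical
  have := Fintype.ofFinite (SpanningCotree o n)
  have hL (L : SpanningCotree o n) :
      ∑ f, (if Set.range f = (L.1.I n)ᶜ then T f else 0) = b.rank.factorial • S L := by
    have h := ((isSpanningCotree_iff o).1 L.2).2.2
    obtain ⟨f₀, hinj, hf₀, -⟩ := b.exists_rows L
    rw [← Finset.sum_filter, Finset.sum_congr rfl fun f hf => hS L f (Finset.mem_filter.1 hf).2
      (b.det_ne_zero (Finset.mem_filter.1 hf).2 h.disjoint), Finset.sum_const]
    simp only [← hf₀]
    rw [card_filter_range_eq hinj, Fintype.card_fin]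
  have hf (f) : ∑ L : SpanningCotree o n, (if Set.range f = (L.1.I n)ᶜ then T f else 0) = T f := by
    by_cases hdet : (b.mat.submatrix f id).det = 0
    · simp [h0 f hdet]
    · simp [← b.cotreeOfRows_eq_iff hdet]
  rw [finsum_eq_sum_of_fintype, Finset.smul_sum, ← Finset.sum_congr rfl fun L _ => hL L,
    Finset.sum_comm]
  exact Finset.sum_congr rfl fun f _ => (hf f).symm

end BoundaryBasis

variable (o n)

instance nonempty_spanningCotree : Nonempty (SpanningCotree o n) := by
  obtain ⟨b⟩ := nonempty_boundaryBasis o n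
  obtain ⟨f, hf⟩ := b.mat.exists_submatrix_det_ne_zero b.injective
  exact ⟨b.cotreeOfRows f hf⟩

variable {o n}

lemma SpanningCotree.isCompl (K : Type) [Field K] [CharZero K] (L : SpanningCotree o n) :
    IsCompl (subChains K L.1 n) (boundaries o K n) := by
  obtain ⟨b⟩ := nonempty_boundaryBasis o n
  obtain ⟨f, -, hf, hdet⟩ := b.exists_rows L
  exact b.isCompl hf hdet

lemma SpanningCotree.card_relCellHomology_ne_zero (L : SpanningCotree o n) :
    Nat.card (RelCellHomology o ℤ L.1 n) ≠ 0 := by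
  obtain ⟨b⟩ := nonempty_boundaryBasis o n
  obtain ⟨f, hinj, hf, hdet⟩ := b.exists_rows L
  rw [b.card_relCellHomology L.2.skeleton_le hf hinj hdet]
  exact Int.natAbs_ne_zero.2 hdet

variable (E : RelCWComplex.cell C n → ℝ) (β : ℝ)

lemma tau_pos (L : SpanningCotree o n) : 0 < tau o n E β L.1 := by
  have h : (Nat.card (RelCellHomology o ℤ L.1 n) : ℝ) ≠ 0 :=
    Nat.cast_ne_zero.2 L.card_relCellHomology_ne_zero
  have hp : 0 < ∏ᶠ e ∈ L.1.I n, Real.exp (-(β * E e)) :=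
    finprod_mem_induction (0 < ·) one_pos (fun _ _ => mul_pos) fun _ _ => Real.exp_pos _
  exact mul_pos (by positivity) hp

variable (o) in
lemma nabla_pos : 0 < nabla o n E β := by
  have := Fintype.ofFinite (SpanningCotree o n)
  rw [nabla, finsum_eq_sum_of_fintype]
  exact Finset.sum_pos (fun L _ => tau_pos E β L) Finset.univ_nonempty

/-! ### The Boltzmann splitting -/

lemma Psi_apply [Fintype (SpanningCotree o n)] (x : Homology o ℝ n) :
    Psi o n E β x = (nabla o n E β)⁻¹ •
      ∑ L : SpanningCotree o n, tau o n E β L.1 • psi o ℝ L.1 n x := by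
  rw [Psi, finsum_eq_sum_of_fintype, LinearMap.smul_apply, LinearMap.sum_apply]
  rfl

/-- `Ψ` is an average of splittings of `Z_n(X; ℝ) → H_n(X; ℝ)`, hence a splitting. -/
lemma homologyClass_Psi (x : Homology o ℝ n) : homologyClass o ℝ n (Psi o n E β x) = x := by
  have := Fintype.ofFinite (SpanningCotree o n)
  rw [Psi_apply, map_smul, map_sum]
  simp only [map_smul, homologyClass_psi o (SpanningCotree.isCompl ℝ _)]
  rw [← Finset.sum_smul, ← finsum_eq_sum_of_fintype]
  exact inv_smul_smul₀ (nabla_pos o E β).ne' x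

/-- The weighted average of the splittings `ψ_L` is orthogonal to the boundaries: up to the factor
`∏ e, exp (-β E e)`, this is the identity which combines Cramer's rule and the Cauchy–Binet
formula. -/
lemma BoundaryBasis.transpose_mulVec_Psi (b : BoundaryBasis o n) (x : Homology o ℝ n) :
    (b.matR ℝ)ᵀ *ᵥ ((fun e => Real.exp (β * E e)) * (Psi o n E β x : Chain C ℝ n)) = 0 := by
  have := Fintype.ofFinite (SpanningCotree o n)
  obtain ⟨z, rfl⟩ := Submodule.mkQ_surjective _ x
  set w : RelCWComplex.cell C n → ℝ := fun e => Real.exp (β * E e)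
  have key := Matrix.sum_weighted_transpose_mulVec_eq_zero (b.matR ℝ) w (z : Chain C ℝ n)
  -- The factor turns the weights of the minors into the weights `τ_L`.
  replace key := congrArg ((∏ e, Real.exp (-(β * E e))) • ·) key
  simp only [Finset.smul_sum, smul_zero, smul_smul] at key
  rw [b.sum_rows_eq _ (fun L => tau o n E β L.1 •
    ((b.matR ℝ)ᵀ *ᵥ (w * (psi o ℝ L.1 n (homologyClass o ℝ n z) : Chain C ℝ n)))) ?_ ?_] at key
  · have hsum := (smul_eq_zero.1 key).resolve_left (Nat.factorial_ne_zero _)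
    rw [finsum_eq_sum_of_fintype] at hsum
    rw [Psi_apply]
    push_cast
    simp only [mul_smul_comm, Matrix.mulVec_smul, Finset.mul_sum, Matrix.mulVec_sum]
    rw [hsum, smul_zero]
  · intro f hdet
    have : (b.minor ℝ f).det = 0 := by rw [det_minor, hdet, Int.cast_zero]
    simp [this]
  · intro L f hf hdet
    rw [b.tau_eq E β L.2.skeleton_le hf (b.injective_of_det_ne_zero hdet) hdet,
      b.coe_psi_homologyClass hf hdet]

lemma adjoint_Psi (x : Homology o ℝ n) : adjoint o E β (Psi o n E β x : Chain C ℝ n) = 0 := by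
  obtain ⟨b⟩ := nonempty_boundaryBasis o n
  obtain ⟨A, hA⟩ := b.exists_incidence_eq
  have h : (incidence o n).map (fun a : ℤ => (a : ℝ)) = b.matR ℝ * A.map (Int.castRingHom ℝ) := by
    rw [BoundaryBasis.matR, ← Matrix.map_mul, ← hA]
    rfl
  rw [adjoint, h, Matrix.transpose_mul, ← Matrix.mulVec_mulVec]
  exact (congrArg _ (b.transpose_mulVec_Psi E β x)).trans (Matrix.mulVec_zero _)

/-- Positivity of the modified inner product makes a co-closed boundary vanish. -/
lemma eq_zero_of_mem_boundaries_of_adjoint_eq_zero {v : Chain C ℝ n}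
    (hv : v ∈ boundaries o ℝ n) (h : adjoint o E β v = 0) : v = 0 := by
  obtain ⟨a, ha⟩ := hv
  have h0 := weightedInner_boundary o n E β a v
  rw [ha, h] at h0
  simp only [Pi.zero_apply, mul_zero, Finset.sum_const_zero, weightedInner] at h0
  rw [Finset.sum_eq_zero_iff_of_nonneg fun e _ =>
    mul_nonneg (Real.exp_pos _).le (mul_self_nonneg _)] at h0
  ext e
  simpa using h0 e (Finset.mem_univ e)

lemma adjoint_sub (v w : Chain C ℝ n) :
    adjoint o E β (v - w) = adjoint o E β v - adjoint o E β w := by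
  simp only [adjoint, ← Matrix.mulVec_sub]
  congr 1
  ext e
  simp [mul_sub]

end Sums

end BoltzmannSplitting

open BoltzmannSplitting in
theorem theoremA {X : Type u} [TopologicalSpace X] [T2Space X] (C : Set X)
    [Topology.CWComplex C] [Topology.CWComplex.Finite C]
    (o : CellOrientation C) (n : ℕ) (E : Topology.RelCWComplex.cell C n → ℝ)
    (β : ℝ) (hβ : 0 < β) :
    Finite (SpanningCotree o n) ∧
    0 < nabla o n E β ∧
    (∀ L : SpanningCotree o n,
      Finite (RelCellHomology o ℤ L.1 n) ∧ Function.Bijective (phi o ℚ L.1 n) ∧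
        Function.Bijective (phi o ℝ L.1 n)) ∧
    ∀ (x : Homology o ℝ n) (ρ : cycles o ℝ n),
      (homologyClass o ℝ n ρ = x ∧ adjoint o E β (ρ : Chain C ℝ n) = 0) ↔
        ρ = Psi o n E β x := by
  refine ⟨inferInstance, nabla_pos o E β, fun L => ⟨?_, phi_bijective o (L.isCompl ℚ),
    phi_bijective o (L.isCompl ℝ)⟩, fun x ρ => ⟨?_, ?_⟩⟩
  · exact Nat.finite_of_card_ne_zero L.card_relCellHomology_ne_zero
  · rintro ⟨hx, hρ⟩
    have hb := (homologyClass_eq_iff o ℝ ρ (Psi o n E β x)).1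
      (hx.trans (homologyClass_Psi E β x).symm)
    exact Subtype.ext (sub_eq_zero.1 (eq_zero_of_mem_boundaries_of_adjoint_eq_zero E β hb
      (by rw [adjoint_sub, hρ, adjoint_Psi, sub_zero])))
  · rintro rfl
    exact ⟨homologyClass_Psi E β x, adjoint_Psi E β x⟩
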